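/- Let $K$ be a field of characteristic zero, let $m\ge 2$ be an integer, and let $A=A(m)=K+\sum_{i\ge m}Kx^i\subseteq K[x]$ be the generalized cusp algebra. Let $\mathcal D(A)=\bigcup_{n\ge 0}\mathcal D_n(A)\subseteq \operatorname{End}_K(A)$ be the ring of $K$-linear differential operators on $A$, where $\mathcal D_{-1}(A)=0$ and, for $n\ge 0$, $\mathcal D_n(A)=\{f\in\operatorname{End}_K(A) : fa-af\in\mathcal D_{n-1}(A)\ \text{for all } a\in A\}$, the elements of $A$ acting on $A$ by multiplication. Then the (left and right) Krull dimension of $\mathcal D(A)$, in the sense of Rentschler and Gabriel (i.e. the deviation of the lattice of left, respectively right, ideals of $\mathcal D(A)$), is equal to $1$. -/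

import Mathlib

universe u v

open Polynomial

/-! ## Krull dimension in the sense of Rentschler and Gabriel -/

/-- The interval `[a, b]` of the poset `P` has deviation at most `α` (including deviation `-∞`):
in every descending chain of elements of the interval, all but finitely many of the factors
`[f (n + 1), f n]` are trivial or have deviation at most some `β < α`. For `α = 0` this is the
descending chain condition. -/
def DevLE {P : Type u} [PartialOrder P] (α : Ordinal.{u}) (a b : P) : Prop :=
  ∀ f : ℕ → P, Antitone f → (∀ n, a ≤ f n ∧ f n ≤ b) →
    ∃ N : ℕ, ∀ n, N ≤ n → f (n + 1) = f n ∨ ∃ β, ∃ _ : β < α, DevLE β (f (n + 1)) (f n)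
termination_by α

/-- `HasKrullDim R M d`: the `R`-module `M` has Krull dimension `d` in the sense of Rentschler and
Gabriel, that is, the lattice of submodules of `M` has deviation `d`. The value `⊥` stands for
`-∞`, the Krull dimension of the zero module. (A module need not have a Krull dimension.) -/
def HasKrullDim (R : Type v) (M : Type u) [Ring R] [AddCommGroup M] [Module R M] :
    WithBot Ordinal.{u} → Prop
  | ⊥ => Subsingleton M
  | (α : Ordinal.{u}) => Nontrivial M ∧ DevLE α (⊥ : Submodule R M) ⊤ ∧
      ∀ β < α, ¬ DevLE β (⊥ : Submodule R M) ⊤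

/-- The Krull dimension of the ring `R` as a left module over itself is `d`
(deviation of the lattice of left ideals). -/
def HasLeftKrullDim (R : Type u) [Ring R] (d : WithBot Ordinal.{u}) : Prop :=
  HasKrullDim R R d

/-- The Krull dimension of the ring `R` as a right module over itself is `d`
(deviation of the lattice of right ideals). -/
def HasRightKrullDim (R : Type u) [Ring R] (d : WithBot Ordinal.{u}) : Prop :=
  HasKrullDim Rᵐᵒᵖ R d

/-! ## The ring of differential operators of a commutative algebra -/

section DiffOp

/-- `diffOpOrderLT K A n` is the space of `K`-linear differential operators on `A` of order less
than `n` (Grothendieck): only `0` has order less than `0`, and `f` has order less than `n + 1` iff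
all commutators `[f, a]`, with `a` in `A` acting by multiplication, have order less than `n`. -/
def diffOpOrderLT (K : Type v) (A : Type u) [Field K] [CommRing A] [Algebra K A] :
    ℕ → Submodule K (Module.End K A)
  | 0 => ⊥
  | n + 1 =>
    { carrier := {f | ∀ a : A, f * LinearMap.mulLeft K a - LinearMap.mulLeft K a * f ∈
        diffOpOrderLT K A n}
      zero_mem' := fun a => by simp
      add_mem' := fun {f g} hf hg a => by
        have := (diffOpOrderLT K A n).add_mem (hf a) (hg a)
        convert this using 1
        noncomm_ring
      smul_mem' := fun c f hf a => by
        have := (diffOpOrderLT K A n).smul_mem c (hf a)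
        convert this using 1
        rw [smul_sub, smul_mul_assoc, mul_smul_comm] }

variable {K : Type v} {A : Type u} [Field K] [CommRing A] [Algebra K A]

theorem mem_diffOpOrderLT_succ {n : ℕ} {f : Module.End K A} :
    f ∈ diffOpOrderLT K A (n + 1) ↔ ∀ a : A,
      f * LinearMap.mulLeft K a - LinearMap.mulLeft K a * f ∈ diffOpOrderLT K A n :=
  Iff.rfl

theorem diffOpOrderLT_le_succ (n : ℕ) : diffOpOrderLT K A n ≤ diffOpOrderLT K A (n + 1) := by
  induction n with
  | zero => exact bot_le
  | succ n ih => exact fun f hf a => ih (hf a)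

theorem diffOpOrderLT_mono : Monotone (diffOpOrderLT K A) :=
  monotone_nat_of_le_succ diffOpOrderLT_le_succ

theorem algebraMap_mem_diffOpOrderLT (c : K) :
    algebraMap K (Module.End K A) c ∈ diffOpOrderLT K A 1 := fun a => by
  rw [Algebra.commutes, sub_self]
  exact Submodule.zero_mem _

theorem mul_mem_diffOpOrderLT (s : ℕ) : ∀ (p q : ℕ), p + q = s → ∀ f g : Module.End K A,
    f ∈ diffOpOrderLT K A p → g ∈ diffOpOrderLT K A q → f * g ∈ diffOpOrderLT K A s := by
  induction s with
  | zero =>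
    intro p q h f g hf _
    obtain rfl : p = 0 := by omega
    have : f = 0 := hf
    rw [this, zero_mul]
    exact Submodule.zero_mem _
  | succ s ih =>
    intro p q h f g hf hg
    rcases p with _ | p
    · have : f = 0 := hf
      rw [this, zero_mul]
      exact Submodule.zero_mem _
    rcases q with _ | q
    · have : g = 0 := hg
      rw [this, mul_zero]
      exact Submodule.zero_mem _
    intro a
    have h1 := ih (p + 1) q (by omega) _ _ hf (hg a)
    have h2 := ih p (q + 1) (by omega) _ _ (hf a) hg
    convert (diffOpOrderLT K A s).add_mem h1 h2 using 1
    rw [mul_sub, sub_mul, mul_assoc, mul_assoc, mul_assoc]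
    abel

variable (K A)

/-- The `K`-algebra `𝒟(A)` of differential operators on the commutative `K`-algebra `A`, a
subalgebra of `End_K(A)`. -/
def diffOps : Subalgebra K (Module.End K A) where
  carrier := {f | ∃ n, f ∈ diffOpOrderLT K A n}
  mul_mem' := fun {f g} ⟨p, hf⟩ ⟨q, hg⟩ => ⟨p + q, mul_mem_diffOpOrderLT _ p q rfl f g hf hg⟩
  add_mem' := fun ⟨p, hf⟩ ⟨q, hg⟩ => ⟨p + q, Submodule.add_mem _
    (diffOpOrderLT_mono (Nat.le_add_right p q) hf) (diffOpOrderLT_mono (Nat.le_add_left q p) hg)⟩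
  algebraMap_mem' := fun c => ⟨1, algebraMap_mem_diffOpOrderLT c⟩

end DiffOp

/-! ## The generalized cusp algebra -/

/-- The generalized cusp algebra `A(m) = K + ∑_{i ≥ m} K x ^ i`, as the subalgebra of `K[x]` of the
polynomials without monomials `x ^ i` for `0 < i < m`. -/
def cuspSubalgebra (K : Type u) [Field K] (m : ℕ) : Subalgebra K K[X] where
  carrier := {p | ∀ i, 0 < i → i < m → p.coeff i = 0}
  mul_mem' := fun {p q} hp hq i h0 hi => by
    rw [coeff_mul]
    refine Finset.sum_eq_zero fun x hx => ?_
    have hx' := Finset.HasAntidiagonal.mem_antidiagonal.mp hx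
    by_cases h : 0 < x.1
    · rw [hp x.1 h (by omega), zero_mul]
    · rw [hq x.2 (by omega) (by omega), mul_zero]
  add_mem' := fun {p q} hp hq i h0 hi => by
    rw [coeff_add, hp i h0 hi, hq i h0 hi, add_zero]
  algebraMap_mem' := fun c i h0 _ => by
    rw [← C_eq_algebraMap, coeff_C, if_neg (by omega)]

/-- `A(m)` is the span of `1` and of the `x ^ i` with `i ≥ m`. -/
theorem cuspSubalgebra_toSubmodule (K : Type u) [Field K] (m : ℕ) :
    Subalgebra.toSubmodule (cuspSubalgebra K m) =
      Submodule.span K ({1} ∪ {p : K[X] | ∃ i, m ≤ i ∧ p = X ^ i}) := by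
  apply le_antisymm
  · intro p hp
    have hp' : ∀ i, 0 < i → i < m → p.coeff i = 0 := hp
    rw [p.as_sum_support_C_mul_X_pow]
    refine Submodule.sum_mem _ fun i hi => ?_
    rw [← smul_eq_C_mul]
    refine Submodule.smul_mem _ _ (Submodule.subset_span ?_)
    by_cases h0 : i = 0
    · left
      simp [h0]
    · right
      refine ⟨i, ?_, rfl⟩
      by_contra h
      exact (mem_support_iff.mp hi) (hp' i (by omega) (by omega))
  · rw [Submodule.span_le]
    rintro p (hp | ⟨i, hi, rfl⟩)
    · rw [Set.mem_singleton_iff.mp hp]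
      exact (cuspSubalgebra K m).one_mem
    · intro j _ hj
      rw [coeff_X_pow, if_neg (by omega)]

/-- The generalized cusp algebra `A(m)` as a type. -/
def CuspAlgebra (K : Type u) [Field K] (m : ℕ) : Type u := cuspSubalgebra K m

noncomputable instance CuspAlgebra.instCommRing (K : Type u) [Field K] (m : ℕ) :
    CommRing (CuspAlgebra K m) :=
  inferInstanceAs (CommRing (cuspSubalgebra K m))

noncomputable instance CuspAlgebra.instAlgebra (K : Type u) [Field K] (m : ℕ) :
    Algebra K (CuspAlgebra K m) :=
  inferInstanceAs (Algebra K (cuspSubalgebra K m))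

/-! ## Deviation and finite filtrations -/

section Deviation

/-! An operator in 𝒟(A) acts by x^s ↦ ∑ P_k(s) x^(s+k) with polynomials P_k
(`exists_isSymbol_of_mem`). The family (P_k) embeds 𝒟(A) in the skew Laurent ring K[θ][x, x⁻¹], θ =
x∂. Hence 𝒟(A) is a domain, filtered by finite-dimensional spaces F_n whose dimension grows
quadratically.

Upper bound: a nonzero left ideal I contains some R a, so I ∩ F_n has at most linearly growing
codimension in F_n (`finrank_le_finrank_inf`). Conversely, a strict inclusion L' < L of left ideals
costs dimension at least n - C in F_n (`finrank_growth_of_lt`). Indeed, take u in L outside L'. If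
no nonzero polynomial in θ sends u into L', the θ^i u are independent modulo L'. Otherwise some
multiple w of u lies outside L' while g(θ) w lies in L', with g irreducible. Operators v_k of weight
k then move w to vectors killed modulo L' by translates of g, which are pairwise coprime in
characteristic zero; they stay outside L' whenever g does not divide q_k, where v_{-k} v_k = q_k(θ).
So strict chains above I have bounded length, every interval [I, ⊤] is artinian, and the deviation
is at most 1.

Lower bound: the left ideals R θ^n decrease strictly. Right ideals follow because the structure
`WeightFiltration` passes to the opposite ring. -/

theorem devLE_zero_iff {P : Type u} [PartialOrder P] {a b : P} :
    DevLE 0 a b ↔ ∀ f : ℕ → P, Antitone f → (∀ n, a ≤ f n ∧ f n ≤ b) →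
      ∃ N : ℕ, ∀ n, N ≤ n → f (n + 1) = f n := by
  rw [DevLE]
  simp

theorem DevLE.zero_mono {P : Type u} [PartialOrder P] {a a' b b' : P} (h : DevLE 0 a b)
    (ha : a ≤ a') (hb : b' ≤ b) : DevLE 0 a' b' := by
  rw [devLE_zero_iff] at h ⊢
  exact fun f hf hab => h f hf fun n => ⟨ha.trans (hab n).1, (hab n).2.trans hb⟩

/-- A lattice with least element whose proper upper intervals are all artinian has deviation at
most one. -/
theorem devLE_one_of_forall {P : Type u} [PartialOrder P] [OrderBot P] [OrderTop P]
    (h : ∀ a : P, a ≠ ⊥ → DevLE 0 a ⊤) : DevLE 1 (⊥ : P) ⊤ := by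
  rw [DevLE]
  intro f hf _
  by_cases hbot : ∃ N, f N = ⊥
  · obtain ⟨N, hN⟩ := hbot
    have key : ∀ n, N ≤ n → f n = ⊥ := fun n hn => le_bot_iff.mp (hN ▸ hf hn)
    exact ⟨N, fun n hn => Or.inl ((key _ (by omega)).trans (key n hn).symm)⟩
  · push Not at hbot
    exact ⟨0, fun n _ => Or.inr ⟨0, zero_lt_one, (h _ (hbot (n + 1))).zero_mono le_rfl le_top⟩⟩

theorem DevLE.zero_orderIso {P Q : Type u} [PartialOrder P] [PartialOrder Q] (e : P ≃o Q)
    {a b : P} (h : DevLE 0 a b) : DevLE 0 (e a) (e b) := by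
  rw [devLE_zero_iff] at h ⊢
  intro f hf hab
  obtain ⟨N, hN⟩ := h (fun n => e.symm (f n)) (fun i j hij => e.symm.monotone (hf hij))
    fun n => ⟨(e.le_symm_apply).mpr (hab n).1, (e.symm_apply_le).mpr (hab n).2⟩
  exact ⟨N, fun n hn => e.symm.injective (hN n hn)⟩

end Deviation

/-! ### Independence modulo a subspace -/

section FiniteDimension

variable {K : Type*} {V : Type*} [Field K] [AddCommGroup V] [Module K V]

/-- A finite family in `M` that is linearly independent modulo `N` bounds the codimension of `N`
in `M` from below. -/
theorem finrank_add_card_le_of_independent_mod {N M : Submodule K V} [FiniteDimensional K M]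
    (hNM : N ≤ M) {ι : Type*} (s : Finset ι) (w : ι → V) (hw : ∀ i ∈ s, w i ∈ M)
    (hind : ∀ c : ι → K, ∑ i ∈ s, c i • w i ∈ N → ∀ i ∈ s, c i = 0) :
    Module.finrank K N + s.card ≤ Module.finrank K M := by
  classical
  have hli : LinearIndependent K (fun i : s => w i) := by
    rw [Fintype.linearIndependent_iff]
    intro c hc i
    have := hind (fun j => if h : j ∈ s then c ⟨j, h⟩ else 0) (by
      rw [← Finset.sum_coe_sort s]
      simp only [Finset.coe_mem, dif_pos, Subtype.coe_eta]
      rw [hc]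
      exact N.zero_mem) i i.2
    simpa using this
  have hfin : FiniteDimensional K N := Submodule.finiteDimensional_of_le hNM
  have hinf : N ⊓ Submodule.span K (Set.range fun i : s => w i) = ⊥ := by
    rw [eq_bot_iff]
    rintro x ⟨hxN, hxW⟩
    obtain ⟨c, rfl⟩ := (Submodule.mem_span_range_iff_exists_fun K).mp hxW
    have hz := hind (fun j => if h : j ∈ s then c ⟨j, h⟩ else 0) (by
      rw [← Finset.sum_coe_sort s]
      simp only [Finset.coe_mem, dif_pos, Subtype.coe_eta]
      exact hxN)
    refine Finset.sum_eq_zero fun i _ => ?_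
    have := hz i i.2
    simp only [Finset.coe_mem, dif_pos] at this
    rw [this, zero_smul]
  have hsup : N ⊔ Submodule.span K (Set.range fun i : s => w i) ≤ M := by
    refine sup_le hNM (Submodule.span_le.mpr ?_)
    rintro _ ⟨i, rfl⟩
    exact hw i i.2
  have hspan : FiniteDimensional K (Submodule.span K (Set.range fun i : s => w i)) :=
    FiniteDimensional.span_of_finite K (Set.finite_range _)
  have h1 := Submodule.finrank_sup_add_finrank_inf_eq N
    (Submodule.span K (Set.range fun i : s => w i))
  rw [hinf, finrank_bot, add_zero, finrank_span_eq_card hli, Fintype.card_coe] at h1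
  rw [← h1]
  exact Submodule.finrank_mono hsup

end FiniteDimension

/-! ## Translates of irreducible polynomials -/

section Translates

variable {K : Type*} [Field K] [CharZero K]

/-- A polynomial invariant under translation by d ≠ 0 takes one value at all n d, infinitely many
points in characteristic zero, so it is constant. -/
theorem eq_zero_of_taylor_eq_self {g : K[X]} (hg : Irreducible g) {d : K}
    (h : taylor d g = g) : d = 0 := by
  by_contra hd
  have hev : ∀ n : ℕ, g.eval (n * d) = g.eval 0 := by
    intro n
    induction n with
    | zero => simp
    | succ n ih =>
      rw [← ih]
      conv_rhs => rw [← h, taylor_eval]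
      congr 1
      push_cast
      ring
  have hz : g - C (g.eval 0) = 0 := by
    refine eq_zero_of_infinite_isRoot _ (Set.infinite_of_injective_forall_mem
      (f := fun n : ℕ => (n : K) * d) ?_ ?_)
    · intro a b hab
      exact_mod_cast mul_right_cancel₀ hd hab
    · intro n
      simp [IsRoot, hev n]
  have hdeg := hg.natDegree_pos
  rw [sub_eq_zero.mp hz, natDegree_C] at hdeg
  exact lt_irrefl _ hdeg

/-- Translates stay irreducible and keep the leading coefficient, so two that are not coprime are
equal, which makes g invariant under translation by a - b. -/
theorem isCoprime_taylor_of_ne {g : K[X]} (hg : Irreducible g) {a b : K} (hab : a ≠ b) :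
    IsCoprime (taylor a g) (taylor b g) := by
  have hirr : ∀ c : K, Irreducible (taylor c g) := fun c =>
    (MulEquiv.irreducible_iff (taylorEquiv c)).mpr hg
  refine ((hirr a).coprime_iff_not_dvd).mpr fun hdvd => hab ?_
  have hassoc : Associated (taylor a g) (taylor b g) :=
    (hirr a).associated_of_dvd (hirr b) hdvd
  have heq : taylor a g = taylor b g := by
    obtain ⟨w, hw⟩ := hassoc
    obtain ⟨c, hc, hcw⟩ := isUnit_iff.mp w.isUnit
    have hl := congrArg leadingCoeff hw
    rw [← hcw, leadingCoeff_mul, leadingCoeff_C, leadingCoeff_taylor, leadingCoeff_taylor] at hl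
    have hne : g.leadingCoeff ≠ 0 := leadingCoeff_ne_zero.mpr hg.ne_zero
    have hc1 : c = 1 := mul_left_cancel₀ hne (by rw [hl, mul_one])
    rw [← hw, ← hcw, hc1, C_1, mul_one]
  have h := congrArg (taylor (-b)) heq
  rw [taylor_taylor, taylor_taylor, neg_add_cancel, taylor_zero] at h
  have := eq_zero_of_taylor_eq_self hg h
  linear_combination this

end Translates

/-! ## Algebras with a filtration of quadratic growth and weight shifting elements -/

/-- A filtration of quadratic growth on a `K`-algebra `R`, together with an element `θ` and elements
`v k` shifting the weights of `θ` by the integers `k`. -/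
structure WeightFiltration (K : Type*) (R : Type*) [Field K] [Ring R] [Algebra K R] where
  /-- The filtration. -/
  F : ℕ → Submodule K R
  finite : ∀ n, FiniteDimensional K (F n)
  mono : Monotone F
  one_mem : 1 ∈ F 0
  mul_mem : ∀ {i j a b}, a ∈ F i → b ∈ F j → a * b ∈ F (i + j)
  exists_mem : ∀ a, ∃ n, a ∈ F n
  /-- The growth constant. -/
  c : ℕ
  finrank_succ_le : ∀ n, Module.finrank K (F (n + 1)) ≤ Module.finrank K (F n) + c * (n + 1)
  /-- The weight element. -/
  θ : R
  theta_mem : θ ∈ F 1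
  theta_ne_zero : θ ≠ 0
  theta_not_isUnit : ¬ IsUnit θ
  /-- The elements shifting the weights. -/
  v : ℤ → R
  /-- The polynomials with `v (-k) * v k = q k (θ)`. -/
  q : ℤ → K[X]
  /-- A bound for the excess of the filtration degree of `v k`. -/
  e : ℕ
  v_mem : ∀ k, v k ∈ F (k.natAbs + e)
  theta_mul_v : ∀ k, θ * v k = v k * (θ + algebraMap K R k)
  v_neg_mul_v : ∀ k, v (-k) * v k = aeval θ (q k)
  q_growth : ∀ g : K[X], Irreducible g → ∃ C : ℕ, ∀ n : ℕ, ∃ s : Finset ℤ,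
    n ≤ s.card + C ∧ ∀ k ∈ s, k.natAbs ≤ n ∧ ¬ g ∣ q k

namespace WeightFiltration

section

variable {K : Type*} {R : Type*} [Field K] [Ring R] [Algebra K R] (W : WeightFiltration K R)

/-- The opposite filtration. -/
def op : WeightFiltration K Rᵐᵒᵖ where
  F n := (W.F n).map (MulOpposite.opLinearEquiv K : R ≃ₗ[K] Rᵐᵒᵖ).toLinearMap
  finite n := by
    have := W.finite n
    infer_instance
  mono i j hij := Submodule.map_mono (W.mono hij)
  one_mem := ⟨1, W.one_mem, rfl⟩
  mul_mem := by
    rintro i j _ _ ⟨a, ha, rfl⟩ ⟨b, hb, rfl⟩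
    exact ⟨b * a, add_comm j i ▸ W.mul_mem hb ha, rfl⟩
  exists_mem a := by
    obtain ⟨n, hn⟩ := W.exists_mem a.unop
    exact ⟨n, a.unop, hn, rfl⟩
  c := W.c
  finrank_succ_le n := by
    simpa only [LinearEquiv.finrank_map_eq] using W.finrank_succ_le n
  θ := MulOpposite.op W.θ
  theta_mem := ⟨_, W.theta_mem, rfl⟩
  theta_ne_zero h := W.theta_ne_zero (MulOpposite.op_injective h)
  theta_not_isUnit h := W.theta_not_isUnit h.unop
  -- Reversing products turns weight k into weight -k; with this sign change v (-k) * v k, and hence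
  -- `q`, is unchanged.
  v k := MulOpposite.op (W.v (-k))
  q := W.q
  e := W.e
  v_mem k := ⟨_, by simpa using W.v_mem (-k), rfl⟩
  theta_mul_v k := by
    have h := W.theta_mul_v (-k)
    apply MulOpposite.unop_injective
    simp only [MulOpposite.unop_mul, MulOpposite.unop_op, MulOpposite.unop_add,
      MulOpposite.algebraMap_apply]
    rw [add_mul, h, mul_add, Algebra.commutes, add_assoc, ← mul_add, ← map_add]
    simp
  v_neg_mul_v k := by
    apply MulOpposite.unop_injective
    have h : (aeval (MulOpposite.op W.θ) (W.q k)).unop = aeval W.θ (W.q k) := by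
      generalize W.q k = p
      induction p using Polynomial.induction_on' with
      | add p r hp hr => simp only [map_add, MulOpposite.unop_add, hp, hr]
      | monomial n a => simp [aeval_monomial, Algebra.commutes]
    rw [h, ← W.v_neg_mul_v k]
    simp
  q_growth := W.q_growth

/-- If g(θ) kills w modulo a left ideal, the translate g(θ - k) kills v_k w. -/
theorem aeval_mul_v (h : K[X]) (k : ℤ) :
    aeval W.θ (taylor (-(k : K)) h) * W.v k = W.v k * aeval W.θ h := by
  have key : ∀ p : K[X], aeval W.θ p * W.v k =
      W.v k * aeval (W.θ + algebraMap K R k) p := by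
    intro p
    induction p using Polynomial.induction_on' with
    | add p r hp hr => rw [map_add, map_add, add_mul, mul_add, hp, hr]
    | monomial n a =>
      have hs : SemiconjBy (W.v k) (W.θ + algebraMap K R k) W.θ := (W.theta_mul_v k).symm
      rw [aeval_monomial, aeval_monomial, mul_assoc, ← (hs.pow_right n).eq, ← mul_assoc,
        Algebra.commutes, mul_assoc]
  rw [key]
  congr 1
  rw [taylor_apply, aeval_comp]
  simp

theorem theta_pow_mem (i : ℕ) : W.θ ^ i ∈ W.F i := by
  induction i with
  | zero => simpa using W.one_mem
  | succ i ih => exact pow_succ W.θ i ▸ W.mul_mem ih W.theta_mem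

theorem mem_of_isCoprime (L : Submodule R R) {a b : K[X]} (hab : IsCoprime a b) {w : R}
    (ha : aeval W.θ a * w ∈ L) (hb : aeval W.θ b * w ∈ L) : w ∈ L := by
  obtain ⟨r, s, hrs⟩ := hab
  have h := congrArg (aeval W.θ) hrs
  rw [map_add, map_mul, map_mul, map_one] at h
  rw [← one_mul w, ← h, add_mul, mul_assoc, mul_assoc]
  exact L.add_mem (L.smul_mem _ ha) (L.smul_mem _ hb)

/-- The constant C may depend on the pair of ideals, but the slope in n is always at least 1; this
is what bounds the length of chains. -/
theorem finrank_growth_of_lt [CharZero K] {L' L : Submodule R R} (hL : L' < L) :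
    ∃ C : ℕ, ∀ n, Module.finrank K (W.F n ⊓ L'.restrictScalars K : Submodule K R) + n ≤
      Module.finrank K (W.F n ⊓ L.restrictScalars K : Submodule K R) + C := by
  classical
  obtain ⟨hle, u, huL, huL'⟩ := SetLike.lt_iff_le_and_exists.mp hL
  have hfin : ∀ n, FiniteDimensional K (W.F n ⊓ L.restrictScalars K : Submodule K R) := fun n =>
    have := W.finite n
    Submodule.finiteDimensional_of_le inf_le_left
  have hmono : ∀ n, (W.F n ⊓ L'.restrictScalars K : Submodule K R) ≤
      W.F n ⊓ L.restrictScalars K := fun n => inf_le_inf_left _ hle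
  by_cases hA : ∃ h : K[X], h ≠ 0 ∧ aeval W.θ h * u ∈ L'
  -- Torsion case: splitting an irreducible factor g off an h of least degree leaves w outside L'
  -- with g(θ) w in L'.
  · obtain ⟨h, ⟨hh0, hhu⟩, hmin⟩ := WellFounded.has_min
      (measure (natDegree : K[X] → ℕ)).wf {h | h ≠ 0 ∧ aeval W.θ h * u ∈ L'} hA
    have hnu : ¬ IsUnit h := by
      intro hu
      obtain ⟨h', hh'⟩ := hu.exists_left_inv
      apply huL'
      have := L'.smul_mem (aeval W.θ h') hhu
      rwa [smul_eq_mul, ← mul_assoc, ← map_mul, hh', map_one, one_mul] at this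
    obtain ⟨g, hg, h', rfl⟩ := WfDvdMonoid.exists_irreducible_factor hnu hh0
    have hh'0 : h' ≠ 0 := right_ne_zero_of_mul hh0
    set w := aeval W.θ h' * u with hw
    have hwL : w ∈ L := L.smul_mem _ huL
    have hwL' : w ∉ L' := by
      intro hmem
      refine hmin h' ⟨hh'0, hmem⟩ ?_
      change h'.natDegree < (g * h').natDegree
      rw [natDegree_mul hg.ne_zero hh'0]
      have := hg.natDegree_pos
      omega
    have hgw : aeval W.θ g * w ∈ L' := by rwa [map_mul, mul_assoc] at hhu
    obtain ⟨s, hs⟩ := W.exists_mem w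
    obtain ⟨C, hC⟩ := W.q_growth g hg
    -- v_k has degree at most |k| + e and w at most s, so |k| ≤ n - e - s keeps v_k w inside F_n;
    -- for n < e + s the constant makes the claim trivial.
    refine ⟨W.e + s + C, fun n => ?_⟩
    obtain ⟨T, hT, hTk⟩ := hC (n - W.e - s)
    by_cases hn : n < W.e + s
    · have := Submodule.finrank_mono (hmono n)
      omega
    have hann : ∀ k : ℤ, aeval W.θ (taylor (-(k : K)) g) * (W.v k * w) ∈ L' := fun k => by
      rw [← mul_assoc, W.aeval_mul_v, mul_assoc]
      exact L'.smul_mem _ hgw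
    -- If v_k w were in L', so would be q_k(θ) w; as g(θ) w is too and g is coprime to q_k, w would
    -- lie in L'.
    have hvw : ∀ k ∈ T, W.v k * w ∉ L' := fun k hk hmem => by
      refine hwL' (W.mem_of_isCoprime L' ((hg.coprime_iff_not_dvd).mpr (hTk k hk).2) hgw ?_)
      rw [← W.v_neg_mul_v, mul_assoc]
      exact L'.smul_mem _ hmem
    have := finrank_add_card_le_of_independent_mod (hmono n) T (fun k => W.v k * w)
      (fun k hk => ⟨W.mono (by have := (hTk k hk).1; omega) (W.mul_mem (W.v_mem k) hs),
        L.smul_mem _ hwL⟩) (by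
      rintro c ⟨-, hc⟩ k hk
      by_contra hck
      -- H(θ) kills every term but the k-th modulo L' and is coprime to the polynomial that kills
      -- the k-th, so a relation would force v_k w into L'.
      set H := ∏ j ∈ T.erase k, taylor (-(j : K)) g with hH
      refine hvw k hk (W.mem_of_isCoprime L' (a := H) (b := taylor (-(k : K)) g) ?_ ?_ (hann k))
      · refine IsCoprime.prod_left fun j hj => isCoprime_taylor_of_ne hg ?_
        simpa using (Finset.mem_erase.mp hj).1
      · have h1 : aeval W.θ H * ∑ j ∈ T, c j • (W.v j * w) ∈ L' := L'.smul_mem _ hc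
        rw [← Finset.add_sum_erase _ _ hk, mul_add, Finset.mul_sum] at h1
        have h2 : ∑ j ∈ T.erase k, aeval W.θ H * c j • (W.v j * w) ∈ L' := by
          refine L'.sum_mem fun j hj => ?_
          obtain ⟨r, hr⟩ := Finset.dvd_prod_of_mem (fun j : ℤ => taylor (-(j : K)) g) hj
          rw [← hH] at hr
          rw [hr, mul_comm, map_mul, mul_assoc, mul_smul_comm]
          exact L'.smul_mem _ ((L'.restrictScalars K).smul_mem _ (hann j))
        have h3 := (L'.add_mem_iff_left h2).mp h1
        rw [mul_smul_comm] at h3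
        exact ((L'.restrictScalars K).smul_mem_iff hck).mp h3)
    omega
  -- Torsion-free case: a relation among the θ^i u modulo L' would be a nonzero polynomial in θ
  -- sending u into L'.
  · push Not at hA
    obtain ⟨s, hs⟩ := W.exists_mem u
    refine ⟨s, fun n => ?_⟩
    have := finrank_add_card_le_of_independent_mod (hmono n) (Finset.range (n + 1 - s))
      (fun i => W.θ ^ i * u)
      (fun i hi => ⟨W.mono (by have := Finset.mem_range.mp hi; omega)
        (W.mul_mem (W.theta_pow_mem i) hs), L.smul_mem _ huL⟩) (by
      rintro c ⟨-, hc⟩ i hi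
      by_contra hci
      refine hA (∑ j ∈ Finset.range (n + 1 - s), monomial j (c j)) ?_ ?_
      · intro h0
        have := congrArg (fun p => coeff p i) h0
        simp only [finsetSum_coeff, coeff_monomial, coeff_zero] at this
        rw [Finset.sum_ite_eq' , if_pos hi] at this
        exact hci this
      · rw [map_sum, Finset.sum_mul]
        have hj : ∀ j, aeval W.θ (monomial j (c j)) * u = c j • (W.θ ^ j * u) := fun j => by
          rw [aeval_monomial, mul_assoc, ← Algebra.smul_def]
        simp only [hj]
        exact hc)
    rw [Finset.card_range] at this
    omega

theorem finrank_le_add (s n : ℕ) :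
    Module.finrank K (W.F (n + s)) ≤ Module.finrank K (W.F n) + s * (W.c * (n + s)) := by
  induction s with
  | zero => simp
  | succ s ih =>
    have h := W.finrank_succ_le (n + s)
    have h2 : s * (W.c * (n + s)) ≤ s * (W.c * (n + (s + 1))) := by gcongr; omega
    calc _ ≤ _ := h
      _ ≤ Module.finrank K (W.F n) + s * (W.c * (n + (s + 1))) + W.c * (n + s + 1) := by omega
      _ = _ := by ring

variable [NoZeroDivisors R]

/-- Right multiplication by a nonzero a in L of degree s embeds F_n in F_(n+s) ∩ L, and quadratic
growth makes F_(n+s) only linearly larger than F_n. -/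
theorem finrank_le_finrank_inf (L : Submodule R R) (hL : L ≠ ⊥) :
    ∃ s : ℕ, ∀ n, Module.finrank K (W.F (n + s)) ≤
      Module.finrank K (W.F (n + s) ⊓ L.restrictScalars K : Submodule K R) +
        s * (W.c * (n + s)) := by
  obtain ⟨a, haL, ha0⟩ := L.ne_bot_iff.mp hL
  obtain ⟨s, hs⟩ := W.exists_mem a
  refine ⟨s, fun n => (W.finrank_le_add s n).trans (Nat.add_le_add_right ?_ _)⟩
  have := W.finite (n + s)
  have hinj : Function.Injective (LinearMap.mulRight K a) := fun x y hxy =>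
    mul_right_cancel₀ ha0 hxy
  rw [(Submodule.equivMapOfInjective _ hinj (W.F n)).finrank_eq]
  have : FiniteDimensional K (W.F (n + s) ⊓ L.restrictScalars K : Submodule K R) :=
    Submodule.finiteDimensional_of_le inf_le_left
  refine Submodule.finrank_mono ?_
  rintro _ ⟨x, hx, rfl⟩
  exact ⟨W.mul_mem hx hs, L.smul_mem x haL⟩

include W in
theorem devLE_zero_of_ne_bot [CharZero K] (I : Submodule R R) (hI : I ≠ ⊥) : DevLE 0 I ⊤ := by
  rw [devLE_zero_iff]
  intro f hf hIf
  by_contra! hcon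
  -- After l strict steps the codimension in F_n is at least l n - C.
  have key : ∀ l : ℕ, ∃ N C : ℕ, ∀ n,
      Module.finrank K (W.F n ⊓ (f N).restrictScalars K : Submodule K R) + l * n ≤
        Module.finrank K (W.F n) + C := by
    intro l
    induction l with
    | zero =>
      refine ⟨0, 0, fun n => ?_⟩
      have := W.finite n
      simpa using Submodule.finrank_mono (inf_le_left :
        (W.F n ⊓ (f 0).restrictScalars K : Submodule K R) ≤ W.F n)
    | succ l ih =>
      obtain ⟨N, C, hC⟩ := ih
      obtain ⟨N', hN', hne⟩ := hcon N
      obtain ⟨C', hC'⟩ := W.finrank_growth_of_lt (lt_of_le_of_ne (hf (Nat.le_add_right N' 1)) hne)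
      refine ⟨N' + 1, C + C', fun n => ?_⟩
      have h1 := hC n
      have h2 := hC' n
      have := W.finite n
      have : FiniteDimensional K (W.F n ⊓ (f N).restrictScalars K : Submodule K R) :=
        Submodule.finiteDimensional_of_le inf_le_left
      have h3 := Submodule.finrank_mono (inf_le_inf_left (W.F n) (hf hN') :
        (W.F n ⊓ (f N').restrictScalars K : Submodule K R) ≤ W.F n ⊓ (f N).restrictScalars K)
      rw [add_mul, one_mul]
      omega
  obtain ⟨s, hs⟩ := W.finrank_le_finrank_inf I hI
  -- One step more than the slope s c allowed by I; the contradiction appears in degree C + 1 + s,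
  -- which exceeds C.
  obtain ⟨N, C, hC⟩ := key (s * W.c + 1)
  have h1 := hs (C + 1)
  have h2 := hC (C + 1 + s)
  have := W.finite (C + 1 + s)
  have : FiniteDimensional K (W.F (C + 1 + s) ⊓ (f N).restrictScalars K : Submodule K R) :=
    Submodule.finiteDimensional_of_le inf_le_left
  have h3 := Submodule.finrank_mono (inf_le_inf_left (W.F (C + 1 + s)) (hIf N).1 :
    (W.F (C + 1 + s) ⊓ I.restrictScalars K : Submodule K R) ≤
      W.F (C + 1 + s) ⊓ (f N).restrictScalars K)
  rw [add_mul, one_mul, mul_assoc] at h2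
  omega

end

/-! ### Left and right Krull dimension -/

variable {K : Type v} {R : Type u} [Field K] [Ring R] [Algebra K R]
  [NoZeroDivisors R] (W : WeightFiltration K R)

include W in
-- If the chain of left ideals generated by the powers of θ stabilised, cancellation would make θ a
-- unit.
theorem not_devLE_zero : ¬ DevLE 0 (⊥ : Submodule R R) ⊤ := by
  rw [devLE_zero_iff]
  intro h
  obtain ⟨N, hN⟩ := h (fun n => Submodule.span R {W.θ ^ n})
    (antitone_nat_of_succ_le fun n => Submodule.span_le.mpr (by
      rintro _ rfl
      rw [pow_succ']
      exact Submodule.smul_mem _ _ (Submodule.mem_span_singleton_self _)))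
    fun n => ⟨bot_le, le_top⟩
  have hmem : W.θ ^ N ∈ Submodule.span R {W.θ ^ (N + 1)} :=
    (hN N le_rfl).symm ▸ Submodule.mem_span_singleton_self _
  obtain ⟨r, hr⟩ := Submodule.mem_span_singleton.mp hmem
  have h1 : r * W.θ = 1 := by
    refine mul_right_cancel₀ (pow_ne_zero N W.theta_ne_zero) ?_
    rw [one_mul, mul_assoc, ← pow_succ']
    exact hr
  have h2 : W.θ * r = 1 := by
    refine mul_right_cancel₀ W.theta_ne_zero ?_
    rw [mul_assoc, h1, mul_one, one_mul]
  exact W.theta_not_isUnit ⟨⟨W.θ, r, h2, h1⟩, rfl⟩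

include W in
theorem hasLeftKrullDim [CharZero K] [Nontrivial R] : HasLeftKrullDim R 1 := by
  refine ⟨inferInstance, devLE_one_of_forall W.devLE_zero_of_ne_bot, fun β hβ => ?_⟩
  rw [Order.lt_one_iff] at hβ
  rw [hβ]
  exact W.not_devLE_zero

include W in
theorem hasRightKrullDim [CharZero K] [Nontrivial R] : HasRightKrullDim R 1 := by
  -- The opposite filtration concerns left ideals of `Rᵐᵒᵖ`, whereas the definition uses
  -- `Rᵐᵒᵖ`-submodules of `R`; `e` identifies the lattices.
  let e : Rᵐᵒᵖ ≃ₗ[Rᵐᵒᵖ] R :=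
    { MulOpposite.opAddEquiv.symm with map_smul' := fun _ _ => rfl }
  let E : Submodule Rᵐᵒᵖ Rᵐᵒᵖ ≃o Submodule Rᵐᵒᵖ R := Submodule.orderIsoMapComap e
  refine ⟨inferInstance, devLE_one_of_forall fun a ha => ?_, fun β hβ => ?_⟩
  · have h := (W.op.devLE_zero_of_ne_bot (E.symm a) (by simpa using ha)).zero_orderIso E
    simpa using h
  · rw [Order.lt_one_iff] at hβ
    rw [hβ]
    intro h
    have h' := h.zero_orderIso E.symm
    rw [map_bot, map_top] at h'
    exact W.op.not_devLE_zero h'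

end WeightFiltration

/-! ## Polynomial interpolation of functions with polynomial differences -/

section Differences

variable {K : Type*} [Field K] [CharZero K]

/-- The Bernoulli polynomials satisfy B_{n+1}(X + 1) - B_{n+1}(X) = (n + 1) X^n, and n + 1 is
invertible. -/
theorem exists_taylor_one_sub_self (h : K[X]) : ∃ g : K[X], taylor 1 g - g = h := by
  induction h using Polynomial.induction_on' with
  | add p q hp hq =>
    obtain ⟨a, rfl⟩ := hp
    obtain ⟨b, rfl⟩ := hq
    exact ⟨a + b, by rw [map_add]; ring⟩
  | monomial n a =>
    refine ⟨C (a / (n + 1 : ℕ)) * (Polynomial.bernoulli (n + 1)).map (algebraMap ℚ K), ?_⟩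
    have hb := congrArg (Polynomial.map (algebraMap ℚ K))
      (Polynomial.bernoulli_comp_one_add_X (n + 1))
    rw [Polynomial.map_comp] at hb
    have hn : ((n + 1 : ℕ) : K) ≠ 0 := Nat.cast_ne_zero.mpr n.succ_ne_zero
    rw [taylor_mul, taylor_C, taylor_apply, C_1, add_comm X 1, ← mul_sub]
    simp only [Polynomial.map_add, Polynomial.map_one, map_X] at hb
    rw [hb, add_sub_cancel_left, Nat.add_sub_cancel, nsmul_eq_mul, Polynomial.map_mul,
      Polynomial.map_natCast, Polynomial.map_pow, map_X, ← mul_assoc, ← C_eq_natCast, ← C_mul,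
      div_mul_cancel₀ _ hn, C_mul_X_pow_eq_monomial]

theorem eq_of_eval_natCast_eq {p q : K[X]} (N : ℕ)
    (h : ∀ n : ℕ, N ≤ n → p.eval (n : K) = q.eval (n : K)) : p = q := by
  rw [← sub_eq_zero]
  refine eq_zero_of_infinite_isRoot _ (Set.infinite_of_injective_forall_mem
    (f := fun n : ℕ => ((n + N : ℕ) : K)) ?_ ?_)
  · intro a b hab
    simpa using hab
  · intro n
    simp only [Set.mem_ofPred_eq, IsRoot, eval_sub]
    rw [h _ (Nat.le_add_left N n), sub_self]

/-- A function on the numerical semigroup generated by `m, m + 1, …` whose differences with steps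
`m` and `m + 1` are polynomial is polynomial. -/
theorem exists_polynomial_of_differences (m : ℕ) (c : ℕ → K) (p q : K[X])
    (hp : ∀ s, (s = 0 ∨ m ≤ s) → c (s + m) - c s = p.eval (s : K))
    (hq : ∀ s, (s = 0 ∨ m ≤ s) → c (s + (m + 1)) - c s = q.eval (s : K)) :
    ∃ g : K[X], ∀ s, (s = 0 ∨ m ≤ s) → c s = g.eval (s : K) := by
  -- Subtracting the two differences at s gives c(s+m+1) - c(s+m) = (q - p)(s), a unit step at t = s
  -- + m. The base point 2 m keeps s ≥ m.
  obtain ⟨g₀, hg₀⟩ := exists_taylor_one_sub_self (taylor (-(m : K)) (q - p))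
  set g := g₀ + C (c (2 * m) - g₀.eval ((2 * m : ℕ) : K)) with hg
  have hstep : ∀ t : ℕ, g.eval ((t + 1 : ℕ) : K) - g.eval (t : K) =
      (q - p).eval ((t : K) - m) := by
    intro t
    have := congrArg (eval (t : K)) hg₀
    rw [eval_sub, taylor_eval, taylor_eval] at this
    rw [sub_eq_add_neg (t : K), ← this, hg]
    simp
  have hlarge : ∀ n : ℕ, c (2 * m + n) = g.eval ((2 * m + n : ℕ) : K) := by
    intro n
    induction n with
    | zero => simp [hg]
    | succ n ih =>
      have h1 := hp (m + n) (Or.inr (by omega))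
      have h2 := hq (m + n) (Or.inr (by omega))
      have h3 := hstep (2 * m + n)
      rw [show m + n + m = 2 * m + n by ring] at h1
      rw [show m + n + (m + 1) = 2 * m + n + 1 by ring] at h2
      have h4 : (((2 * m + n : ℕ) : K) - m) = ((m + n : ℕ) : K) := by push_cast; ring
      rw [h4, eval_sub, ← h1, ← h2, ← ih] at h3
      rw [← add_assoc]
      linear_combination -h3
  -- Holding at all large integers, this is an identity of polynomials, so the step m can be run
  -- backwards to the small exponents, including 0.
  have hpoly : taylor (m : K) g - g = p := by
    refine eq_of_eval_natCast_eq (2 * m) fun n hn => ?_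
    obtain ⟨t, rfl⟩ := Nat.exists_eq_add_of_le hn
    rw [eval_sub, taylor_eval, ← hp _ (Or.inr (by omega)), hlarge, add_assoc, hlarge]
    push_cast
    ring_nf
  have hback : ∀ s, (s = 0 ∨ m ≤ s) → c (s + m) = g.eval ((s + m : ℕ) : K) →
      c s = g.eval (s : K) := by
    intro s hs h
    have h1 := hp s hs
    rw [← hpoly, eval_sub, taylor_eval, h] at h1
    push_cast at h1
    linear_combination -h1
  have hge : ∀ s, m ≤ s → c s = g.eval (s : K) := by
    intro s hs
    refine hback s (Or.inr hs) ?_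
    obtain ⟨t, rfl⟩ := Nat.exists_eq_add_of_le hs
    rw [show m + t + m = 2 * m + t by ring]
    exact hlarge t
  refine ⟨g, ?_⟩
  rintro s (rfl | hs)
  · exact hback 0 (Or.inl rfl) (hge _ (by omega))
  · exact hge s hs

end Differences

/-! ## Coefficients indexed by integers -/

section IntCoeff

variable {K : Type*} [Field K]

/-- The coefficient of `X ^ j` for an integer `j`. -/
noncomputable def intCoeff (j : ℤ) : K[X] →ₗ[K] K :=
  if 0 ≤ j then lcoeff K j.toNat else 0

theorem intCoeff_natCast (n : ℕ) (p : K[X]) : intCoeff (n : ℤ) p = p.coeff n := by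
  simp [intCoeff]

theorem intCoeff_of_neg {j : ℤ} (hj : j < 0) (p : K[X]) : intCoeff j p = 0 := by
  simp [intCoeff, not_le.mpr hj]

theorem intCoeff_X_pow (n : ℕ) (j : ℤ) :
    intCoeff j (X ^ n : K[X]) = if j = n then 1 else 0 := by
  rcases lt_or_ge j 0 with hj | hj
  · rw [intCoeff_of_neg hj, if_neg (by omega)]
  · lift j to ℕ using hj
    rw [intCoeff_natCast, coeff_X_pow]
    simp

theorem intCoeff_X_pow_mul (n : ℕ) (j : ℤ) (p : K[X]) :
    intCoeff j (X ^ n * p) = intCoeff (j - n) p := by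
  rcases lt_or_ge j 0 with hj | hj
  · rw [intCoeff_of_neg hj, intCoeff_of_neg (by omega)]
  · lift j to ℕ using hj
    rw [intCoeff_natCast, coeff_X_pow_mul']
    split_ifs with h
    · rw [← Nat.cast_sub h, intCoeff_natCast]
    · rw [intCoeff_of_neg (by omega)]

end IntCoeff

/-! ## The skew product of symbols -/

section Skew

variable {K : Type*} [Field K]

/-- The product of finitely supported families of polynomials, regarded as Laurent polynomials
`∑ x ^ k P_k(θ)` with `θ x = x (θ + 1)`. -/
noncomputable def skewMul (P Q : ℤ →₀ K[X]) : ℤ →₀ K[X] :=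
  P.sum fun k p => Q.sum fun l q => Finsupp.single (k + l) (taylor (l : K) p * q)

theorem skewMul_apply (P Q : ℤ →₀ K[X]) (j : ℤ) :
    skewMul P Q j = ∑ k ∈ P.support, taylor ((j - k : ℤ) : K) (P k) * Q (j - k) := by
  rw [skewMul, Finsupp.sum, Finsupp.finsetSum_apply]
  refine Finset.sum_congr rfl fun k _ => ?_
  rw [Finsupp.sum_apply, Finsupp.sum, Finset.sum_eq_single (j - k)]
  · simp
  · intro l _ hl
    rw [Finsupp.single_apply, if_neg (by omega)]
  · intro h
    rw [Finsupp.notMem_support_iff.mp h]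
    simp

theorem skewMul_single (k l : ℤ) (p q : K[X]) :
    skewMul (Finsupp.single k p) (Finsupp.single l q) =
      Finsupp.single (k + l) (taylor (l : K) p * q) := by
  rw [skewMul, Finsupp.sum_single_index, Finsupp.sum_single_index] <;> simp

/-- The terms of highest degree in x multiply to a nonzero product, since translation is injective
on polynomials. -/
theorem skewMul_ne_zero {P Q : ℤ →₀ K[X]} (hP : P ≠ 0) (hQ : Q ≠ 0) : skewMul P Q ≠ 0 := by
  have hP' := Finsupp.support_nonempty_iff.mpr hP
  have hQ' := Finsupp.support_nonempty_iff.mpr hQ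
  set a := P.support.max' hP' with ha
  set b := Q.support.max' hQ' with hb
  have haP : P a ≠ 0 := Finsupp.mem_support_iff.mp (P.support.max'_mem hP')
  have hbQ : Q b ≠ 0 := Finsupp.mem_support_iff.mp (Q.support.max'_mem hQ')
  intro h
  have h1 := DFunLike.congr_fun h (a + b)
  rw [skewMul_apply, Finset.sum_eq_single a, Finsupp.zero_apply, mul_eq_zero] at h1
  · rw [add_sub_cancel_left] at h1
    refine h1.elim (fun h2 => haP ?_) hbQ
    exact taylor_injective _ (by rw [h2, map_zero])
  · intro k hk hka
    have hlt := lt_of_le_of_ne (P.support.le_max' k hk) hka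
    have : Q (a + b - k) = 0 := by
      by_contra hne
      have := Q.support.le_max' _ (Finsupp.mem_support_iff.mpr hne)
      omega
    rw [this, mul_zero]
  · intro hna
    exact absurd (P.support.max'_mem hP') hna

/-- The symbols of degree at most `n` in `x`, `x⁻¹` and in `θ`. -/
def symbolBox (K : Type*) [Field K] (n : ℕ) : Submodule K (ℤ →₀ K[X]) where
  carrier := {P | ∀ k j, ¬ (k.natAbs ≤ n ∧ j ≤ n) → (P k).coeff j = 0}
  zero_mem' := fun k j _ => by simp
  add_mem' := fun {P Q} hP hQ k j h => by simp [hP k j h, hQ k j h]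
  smul_mem' := fun c P hP k j h => by simp [hP k j h]

theorem mem_symbolBox_iff {n : ℕ} {P : ℤ →₀ K[X]} :
    P ∈ symbolBox K n ↔ ∀ k, P k ≠ 0 → k.natAbs ≤ n ∧ (P k).natDegree ≤ n := by
  constructor
  · intro h k hk
    have h1 := mt (h k (P k).natDegree)
    rw [not_not] at h1
    exact h1 (by simpa using hk)
  · intro h k j hkj
    by_contra hne
    have hk : P k ≠ 0 := fun h0 => hne (by simp [h0])
    exact hkj ⟨(h k hk).1, (le_natDegree_of_ne_zero hne).trans (h k hk).2⟩

theorem single_mem_symbolBox {n : ℕ} {k : ℤ} {p : K[X]} (hk : k.natAbs ≤ n)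
    (hp : p.natDegree ≤ n) : Finsupp.single k p ∈ symbolBox K n := by
  rw [mem_symbolBox_iff]
  intro j hj
  obtain rfl : k = j := by
    by_contra hne
    exact hj (Finsupp.single_eq_of_ne' hne)
  simpa using ⟨hk, hp⟩

theorem skewMul_mem_symbolBox {i j : ℕ} {P Q : ℤ →₀ K[X]} (hP : P ∈ symbolBox K i)
    (hQ : Q ∈ symbolBox K j) : skewMul P Q ∈ symbolBox K (i + j) := by
  rw [mem_symbolBox_iff] at *
  intro k hk
  rw [skewMul_apply] at hk ⊢
  constructor
  · obtain ⟨l, hl, hne⟩ := Finset.exists_ne_zero_of_sum_ne_zero hk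
    have h1 := (hP l (Finsupp.mem_support_iff.mp hl)).1
    have h2 := (hQ _ (right_ne_zero_of_mul hne)).1
    omega
  · refine natDegree_sum_le_of_forall_le _ _ fun l hl => ?_
    by_cases hQ0 : Q (k - l) = 0
    · simp [hQ0]
    · refine natDegree_mul_le.trans (add_le_add ?_ (hQ _ hQ0).2)
      rw [natDegree_taylor]
      exact (hP l (Finsupp.mem_support_iff.mp hl)).2

theorem symbolBox_mono : Monotone (symbolBox K) := fun i j hij P hP => by
  rw [mem_symbolBox_iff] at *
  exact fun k hk => ⟨(hP k hk).1.trans hij, (hP k hk).2.trans hij⟩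

theorem exists_mem_symbolBox (P : ℤ →₀ K[X]) : ∃ n, P ∈ symbolBox K n := by
  refine ⟨P.support.sup fun k => k.natAbs + (P k).natDegree, ?_⟩
  rw [mem_symbolBox_iff]
  intro k hk
  have := Finset.le_sup (f := fun k => k.natAbs + (P k).natDegree) (Finsupp.mem_support_iff.mpr hk)
  omega

/-- The exponents of the monomials in `symbolBox K n`. -/
noncomputable def boxIndex (n : ℕ) : Finset (ℤ × ℕ) := Finset.Icc (-(n : ℤ)) n ×ˢ Finset.range (n + 1)

theorem mem_boxIndex {n : ℕ} {x : ℤ × ℕ} : x ∈ boxIndex n ↔ x.1.natAbs ≤ n ∧ x.2 ≤ n := by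
  simp only [boxIndex, Finset.mem_product, Finset.mem_Icc, Finset.mem_range]
  omega

theorem card_boxIndex (n : ℕ) : (boxIndex n).card = (2 * n + 1) * (n + 1) := by
  rw [boxIndex, Finset.card_product, Int.card_Icc, Finset.card_range]
  congr 1
  omega

/-- The coefficients of a symbol with exponents in a finite set. -/
noncomputable def symbolCoeffs (s : Finset (ℤ × ℕ)) : (ℤ →₀ K[X]) →ₗ[K] (s → K) where
  toFun P x := (P x.1.1).coeff x.1.2
  map_add' P Q := by ext; simp
  map_smul' c P := by ext; simp

theorem symbolBox_inf_ker (n : ℕ) :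
    symbolBox K n ⊓ LinearMap.ker (symbolCoeffs (boxIndex n)) = ⊥ := by
  rw [eq_bot_iff]
  rintro P ⟨hP, hk⟩
  ext k j
  by_cases h : k.natAbs ≤ n ∧ j ≤ n
  · exact congrFun (LinearMap.mem_ker.mp hk) ⟨(k, j), mem_boxIndex.mpr h⟩
  · exact hP k j h

theorem symbolBox_succ_inf_ker (n : ℕ) : symbolBox K (n + 1) ⊓
    LinearMap.ker (symbolCoeffs (boxIndex (n + 1) \ boxIndex n)) ≤ symbolBox K n := by
  rintro P ⟨hP, hk⟩ k j hkj
  by_cases h : k.natAbs ≤ n + 1 ∧ j ≤ n + 1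
  · exact congrFun (LinearMap.mem_ker.mp hk) ⟨(k, j), Finset.mem_sdiff.mpr
      ⟨mem_boxIndex.mpr h, mt mem_boxIndex.mp hkj⟩⟩
  · exact hP k j h

theorem card_boxIndex_sdiff_le (n : ℕ) :
    (boxIndex (n + 1) \ boxIndex n).card ≤ 5 * (n + 1) := by
  have hsub : boxIndex n ⊆ boxIndex (n + 1) := fun x hx => by
    rw [mem_boxIndex] at *
    omega
  rw [Finset.card_sdiff_of_subset hsub, card_boxIndex, card_boxIndex, tsub_le_iff_right]
  -- The difference of the two cardinalities is 4 n + 5.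
  nlinarith

variable {V : Type*} [AddCommGroup V] [Module K V] (σ : V →ₗ[K] (ℤ →₀ K[X]))
  (hσ : Function.Injective σ)

include hσ

theorem finite_comap_symbolBox (n : ℕ) : FiniteDimensional K ((symbolBox K n).comap σ) := by
  refine FiniteDimensional.of_injective
    ((symbolCoeffs (boxIndex n) ∘ₗ σ).domRestrict ((symbolBox K n).comap σ)) ?_
  rw [← LinearMap.ker_eq_bot, eq_bot_iff]
  rintro ⟨x, hx⟩ hk
  have h : σ x ∈ symbolBox K n ⊓ LinearMap.ker (symbolCoeffs (boxIndex n)) := ⟨hx, hk⟩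
  rw [symbolBox_inf_ker] at h
  exact Subtype.ext (hσ (by simpa using h))

/-- Reading off the coefficients in the shell between the boxes has its kernel in the smaller space.
-/
theorem finrank_comap_symbolBox_succ_le (n : ℕ) :
    Module.finrank K ((symbolBox K (n + 1)).comap σ) ≤
      Module.finrank K ((symbolBox K n).comap σ) + 5 * (n + 1) := by
  have h1 := finite_comap_symbolBox σ hσ (n + 1)
  have h0 := finite_comap_symbolBox σ hσ n
  set φ := (symbolCoeffs (boxIndex (n + 1) \ boxIndex n) ∘ₗ σ).domRestrict
    ((symbolBox K (n + 1)).comap σ) with hφ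
  rw [← φ.finrank_range_add_finrank_ker, add_comm]
  refine add_le_add ?_ ?_
  · refine LinearMap.finrank_le_finrank_of_injective (f := LinearMap.codRestrict _
      (((symbolBox K (n + 1)).comap σ).subtype ∘ₗ (LinearMap.ker φ).subtype)
      fun x => symbolBox_succ_inf_ker n ⟨x.1.2, x.2⟩) ?_
    intro x y hxy
    have h : ((x : (symbolBox K (n + 1)).comap σ) : V) = (y : (symbolBox K (n + 1)).comap σ) :=
      congrArg (Subtype.val : (symbolBox K n).comap σ → V) hxy
    exact Subtype.ext (Subtype.ext h)
  · refine (Submodule.finrank_le _).trans ?_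
    rw [Module.finrank_fintype_fun_eq_card, Fintype.card_coe]
    exact card_boxIndex_sdiff_le n

end Skew

/-! ## Algebras with a symbol map -/

section OfSymbol

variable {K : Type*} [Field K] {R : Type*} [Ring R] [Algebra K R]
  (σ : R →ₗ[K] (ℤ →₀ K[X])) (hσ : Function.Injective σ)
  (σ_one : σ 1 = Finsupp.single 0 1) (σ_mul : ∀ a b, σ (a * b) = skewMul (σ a) (σ b))

include hσ σ_mul in
theorem noZeroDivisors_of_symbol : NoZeroDivisors R where
  eq_zero_or_eq_zero_of_mul_eq_zero {a b} h := by
    by_contra! hne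
    refine skewMul_ne_zero (P := σ a) (Q := σ b) ?_ ?_ ?_
    · exact (map_ne_zero_iff _ hσ).mpr hne.1
    · exact (map_ne_zero_iff _ hσ).mpr hne.2
    · rw [← σ_mul, h, map_zero]

include σ_one in
theorem nontrivial_of_symbol : Nontrivial R := by
  refine ⟨1, 0, fun h => ?_⟩
  have h1 := congrArg σ h
  rw [σ_one, map_zero, Finsupp.single_eq_zero] at h1
  exact one_ne_zero h1

include σ_one σ_mul in
theorem symbol_aeval {θ : R} (hθ : σ θ = Finsupp.single 0 X) (p : K[X]) :
    σ (aeval θ p) = Finsupp.single 0 p := by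
  have hpow : ∀ n : ℕ, σ (θ ^ n) = Finsupp.single 0 (X ^ n) := by
    intro n
    induction n with
    | zero => rw [pow_zero, pow_zero, σ_one]
    | succ n ih => rw [pow_succ, σ_mul, ih, hθ, skewMul_single]; simp [pow_succ]
  induction p using Polynomial.induction_on' with
  | add p q hp hq => rw [map_add, map_add, hp, hq, Finsupp.single_add]
  | monomial n a =>
    rw [aeval_monomial, ← Algebra.smul_def, map_smul, hpow, Finsupp.smul_single, smul_eq_C_mul,
      C_mul_X_pow_eq_monomial]

/-- The filtration of an algebra with a symbol map by the degree of the symbols in `x`, `x⁻¹` and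
in `θ`. -/
noncomputable def WeightFiltration.ofSymbol {θ : R} (hθ : σ θ = Finsupp.single 0 X) {v : ℤ → R}
    {p : ℤ → K[X]} (hv : ∀ k, σ (v k) = Finsupp.single k (p k)) {e : ℕ}
    (hp : ∀ k, (p k).natDegree ≤ k.natAbs + e)
    (growth : ∀ g : K[X], Irreducible g → ∃ C : ℕ, ∀ n : ℕ, ∃ s : Finset ℤ,
      n ≤ s.card + C ∧ ∀ k ∈ s, k.natAbs ≤ n ∧ ¬ g ∣ taylor (k : K) (p (-k)) * p k) :
    WeightFiltration K R where
  F n := (symbolBox K n).comap σ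
  finite := finite_comap_symbolBox σ hσ
  mono i j hij := Submodule.comap_mono (symbolBox_mono hij)
  one_mem := by
    rw [Submodule.mem_comap, σ_one]
    exact single_mem_symbolBox (by simp) (by simp)
  mul_mem ha hb := by
    rw [Submodule.mem_comap, σ_mul]
    exact skewMul_mem_symbolBox ha hb
  exists_mem a := exists_mem_symbolBox (σ a)
  c := 5
  finrank_succ_le := finrank_comap_symbolBox_succ_le σ hσ
  θ := θ
  theta_mem := by
    rw [Submodule.mem_comap, hθ]
    exact single_mem_symbolBox (by simp) (by simp)
  theta_ne_zero h := by
    rw [h, map_zero, eq_comm, Finsupp.single_eq_zero] at hθ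
    exact X_ne_zero hθ
  theta_not_isUnit h := by
    obtain ⟨r, hr⟩ := h.exists_right_inv
    have h1 := congrArg σ hr
    rw [σ_mul, hθ, σ_one] at h1
    -- The component of weight 0 would give X p = 1 for a polynomial p, which fails at 0.
    have h2 := DFunLike.congr_fun h1 0
    rw [skewMul_apply, Finsupp.single_eq_same,
      Finsupp.support_single (hb := (X_ne_zero : (X : K[X]) ≠ 0)), Finset.sum_singleton] at h2
    simpa using congrArg (eval 0) h2
  v := v
  q k := taylor (k : K) (p (-k)) * p k
  e := e
  v_mem k := by
    rw [Submodule.mem_comap, hv]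
    exact single_mem_symbolBox (by omega) (hp k)
  theta_mul_v k := by
    apply hσ
    rw [σ_mul, σ_mul, map_add, hθ, hv, Algebra.algebraMap_eq_smul_one, map_smul, σ_one,
      Finsupp.smul_single, smul_eq_C_mul, mul_one, ← Finsupp.single_add, skewMul_single,
      skewMul_single]
    simp [mul_comm]
  v_neg_mul_v k := by
    apply hσ
    rw [σ_mul, hv, hv, skewMul_single, symbol_aeval σ σ_one σ_mul hθ, neg_add_cancel]
  q_growth := growth

end OfSymbol

/-! ## Differential operators on the cusp algebra -/

namespace CuspAlgebra

section Basic

variable {K : Type u} [Field K] {m : ℕ}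

/-- The integers that occur as exponents in `A(m)`. -/
def IsExponent (m : ℕ) (j : ℤ) : Prop := j = 0 ∨ (m : ℤ) ≤ j

instance : DecidablePred (IsExponent m) := fun j =>
  inferInstanceAs (Decidable (j = 0 ∨ (m : ℤ) ≤ j))

theorem isExponent_natCast {s : ℕ} : IsExponent m s ↔ s = 0 ∨ m ≤ s := by
  simp [IsExponent]

/-- The inclusion of `A(m)` into `K[X]`. -/
noncomputable def incl (K : Type u) [Field K] (m : ℕ) : CuspAlgebra K m →ₐ[K] K[X] :=
  (cuspSubalgebra K m).val

/-- A polynomial of the cusp algebra as an element of `A(m)`. -/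
noncomputable def ofMem (p : K[X]) (hp : p ∈ cuspSubalgebra K m) : CuspAlgebra K m :=
  (⟨p, hp⟩ : cuspSubalgebra K m)

theorem incl_ofMem (p : K[X]) (hp : p ∈ cuspSubalgebra K m) : incl K m (ofMem p hp) = p := rfl

theorem incl_injective : Function.Injective (incl K m) := Subtype.val_injective

theorem incl_coeff_eq_zero (a : CuspAlgebra K m) {i : ℕ} (hi : ¬ IsExponent m i) :
    (incl K m a).coeff i = 0 := by
  rw [isExponent_natCast] at hi
  exact a.2 i (by omega) (by omega)

theorem ext_intCoeff {a b : CuspAlgebra K m}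
    (h : ∀ j : ℤ, intCoeff j (incl K m a) = intCoeff j (incl K m b)) : a = b := by
  apply incl_injective
  ext n
  simpa only [intCoeff_natCast] using h n

theorem X_pow_mem {s : ℕ} (hs : IsExponent m s) : (X ^ s : K[X]) ∈ cuspSubalgebra K m := by
  rw [isExponent_natCast] at hs
  intro i h0 hi
  rw [coeff_X_pow, if_neg (by omega)]

/-- The monomial `x ^ s` of `A(m)`, for exponents `s`. -/
noncomputable def mono (K : Type u) [Field K] (m s : ℕ) : CuspAlgebra K m :=
  if hs : IsExponent m s then ofMem (X ^ s) (X_pow_mem hs) else 0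

theorem incl_mono {s : ℕ} (hs : IsExponent m s) : incl K m (mono K m s) = X ^ s := by
  rw [mono, dif_pos hs, incl_ofMem]

theorem isExponent_add {s t : ℕ} (hs : IsExponent m s) (ht : IsExponent m t) :
    IsExponent m (s + t : ℕ) := by
  rw [isExponent_natCast] at *
  omega

theorem mono_mul_mono {s t : ℕ} (hs : IsExponent m s) (ht : IsExponent m t) :
    mono K m s * mono K m t = mono K m (s + t) := by
  apply incl_injective
  rw [map_mul, incl_mono hs, incl_mono ht, incl_mono (isExponent_add hs ht), pow_add]

theorem eq_sum_mono (a : CuspAlgebra K m) :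
    a = ∑ s ∈ (incl K m a).support, (incl K m a).coeff s • mono K m s := by
  apply incl_injective
  rw [map_sum]
  conv_lhs => rw [(incl K m a).as_sum_support_C_mul_X_pow]
  refine Finset.sum_congr rfl fun s hs => ?_
  have he : IsExponent m s := by
    by_contra hne
    exact mem_support_iff.mp hs (incl_coeff_eq_zero a hne)
  rw [map_smul, incl_mono he, smul_eq_C_mul]

/-- A subspace of `A(m)` that contains the monomials is everything. -/
theorem mem_of_mono_mem (N : Submodule K (CuspAlgebra K m))
    (h : ∀ s : ℕ, IsExponent m s → mono K m s ∈ N) (a : CuspAlgebra K m) : a ∈ N := by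
  rw [eq_sum_mono a]
  refine N.sum_mem fun s hs => N.smul_mem _ (h s ?_)
  by_contra hne
  exact mem_support_iff.mp hs (incl_coeff_eq_zero a hne)

/-- The operator `f` has the symbol `P` if `f (x ^ s) = ∑ P_k(s) x ^ (s + k)`. -/
def IsSymbol (f : Module.End K (CuspAlgebra K m)) (P : ℤ →₀ K[X]) : Prop :=
  ∀ s : ℕ, IsExponent m s → ∀ k : ℤ,
    intCoeff (s + k) (incl K m (f (mono K m s))) = (P k).eval (s : K)

/-! ### Calculus of symbols -/

namespace IsSymbol

variable {f g : Module.End K (CuspAlgebra K m)} {P Q : ℤ →₀ K[X]}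

theorem add (hf : IsSymbol f P) (hg : IsSymbol g Q) : IsSymbol (f + g) (P + Q) :=
  fun s hs k => by simp [hf s hs k, hg s hs k]

theorem smul (c : K) (hf : IsSymbol f P) : IsSymbol (c • f) (c • P) :=
  fun s hs k => by simp [hf s hs k]

theorem sub (hf : IsSymbol f P) (hg : IsSymbol g Q) : IsSymbol (f - g) (P - Q) :=
  fun s hs k => by simp [hf s hs k, hg s hs k]

theorem unique [CharZero K] (hP : IsSymbol f P) (hQ : IsSymbol f Q) : P = Q := by
  refine Finsupp.ext fun k => eq_of_eval_natCast_eq m fun n hn => ?_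
  have hs : IsExponent m n := isExponent_natCast.mpr (Or.inr hn)
  rw [← hP n hs, hQ n hs]

theorem ext (hf : IsSymbol f P) (hg : IsSymbol g P) : f = g := by
  ext a
  refine mem_of_mono_mem (LinearMap.eqLocus f g) (fun s hs => ext_intCoeff fun j => ?_) a
  have h1 := hf s hs (j - s)
  rw [← hg s hs, add_sub_cancel] at h1
  exact h1

theorem intCoeff_apply (hf : IsSymbol f P) (a : CuspAlgebra K m) (i : ℤ) :
    intCoeff i (incl K m (f a)) =
      ∑ k ∈ P.support, (P k).eval ((i - k : ℤ) : K) * intCoeff (i - k) (incl K m a) := by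
  let N : Submodule K (CuspAlgebra K m) := LinearMap.eqLocus
    (intCoeff i ∘ₗ (incl K m).toLinearMap ∘ₗ f)
    (∑ k ∈ P.support,
      (P k).eval ((i - k : ℤ) : K) • (intCoeff (i - k) ∘ₗ (incl K m).toLinearMap))
  have key : a ∈ N := by
    refine mem_of_mono_mem N (fun s hs => ?_) a
    have h := hf s hs (i - s)
    rw [add_sub_cancel] at h
    simp only [N, LinearMap.mem_eqLocus, LinearMap.comp_apply, AlgHom.toLinearMap_apply, h,
      LinearMap.sum_apply, LinearMap.smul_apply, incl_mono hs, intCoeff_X_pow, smul_eq_mul]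
    rw [Finset.sum_eq_single (i - s)]
    · simp
    · intro k _ hk
      rw [if_neg (by omega), mul_zero]
    · intro hk
      rw [Finsupp.notMem_support_iff.mp hk]
      simp
  simpa [N, LinearMap.mem_eqLocus] using key

theorem mul (hf : IsSymbol f P) (hg : IsSymbol g Q) : IsSymbol (f * g) (skewMul P Q) := by
  intro s hs j
  rw [Module.End.mul_apply, hf.intCoeff_apply, skewMul_apply, eval_finsetSum]
  refine Finset.sum_congr rfl fun k _ => ?_
  rw [eval_mul, taylor_eval, add_sub_assoc, hg s hs]
  push_cast
  rfl

theorem mulLeft_mono {j : ℕ} (hj : IsExponent m j) :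
    IsSymbol (LinearMap.mulLeft K (mono K m j)) (Finsupp.single (j : ℤ) 1) := by
  intro s hs k
  rw [LinearMap.mulLeft_apply, mono_mul_mono hj hs, incl_mono (isExponent_add hj hs),
    intCoeff_X_pow]
  by_cases hk : k = j
  · subst hk
    simp [add_comm]
  · rw [Finsupp.single_eq_of_ne hk, if_neg (by push_cast; omega), eval_zero]

theorem one : IsSymbol (1 : Module.End K (CuspAlgebra K m)) (Finsupp.single 0 1) := by
  intro s hs k
  rw [Module.End.one_apply, incl_mono hs, intCoeff_X_pow]
  by_cases hk : k = 0
  · subst hk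
    simp
  · rw [Finsupp.single_eq_of_ne hk, if_neg (by omega), eval_zero]

theorem commutator_mono (hf : IsSymbol f P) {j : ℕ} (hj : IsExponent m j) :
    ∃ Q : ℤ →₀ K[X], (∀ k, Q k = taylor (j : K) (P (k - j)) - P (k - j)) ∧
      IsSymbol (f * LinearMap.mulLeft K (mono K m j) - LinearMap.mulLeft K (mono K m j) * f) Q := by
  refine ⟨_, fun k => ?_, (hf.mul (mulLeft_mono hj)).sub ((mulLeft_mono hj).mul hf)⟩
  rw [Finsupp.sub_apply, skewMul_apply, skewMul_apply, Finset.sum_eq_single (k - j),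
    Finset.sum_eq_single (j : ℤ)]
  · simp
  · intro l hl hlj
    rw [Finsupp.single_eq_of_ne hlj]
    simp
  · intro h
    rw [Finsupp.notMem_support_iff.mp h]
    simp
  · intro l _ hl
    rw [Finsupp.single_eq_of_ne (by omega), mul_zero]
  · intro h
    rw [Finsupp.notMem_support_iff.mp h]
    simp

/-- A commutator with x^j replaces each P_k by a difference P_k(θ + j) - P_k(θ), which lowers the
degree; by linearity, monomials suffice. -/
theorem mem_diffOpOrderLT [CharZero K] (n : ℕ) : ∀ (f : Module.End K (CuspAlgebra K m))
    (P : ℤ →₀ K[X]), IsSymbol f P → (∀ k, (P k).degree < n) →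
      f ∈ diffOpOrderLT K (CuspAlgebra K m) n := by
  induction n with
  | zero =>
    intro f P hf hP
    have h0 : P = 0 := Finsupp.ext fun k => by simpa using hP k
    have : f = 0 := by
      refine hf.ext ?_
      rw [h0]
      intro s _ k
      simp
    rw [this]
    exact Submodule.zero_mem _
  | succ n ih =>
    intro f P hf hP a
    let N : Submodule K (CuspAlgebra K m) := (diffOpOrderLT K (CuspAlgebra K m) n).comap
      ((LinearMap.mulLeft K f - LinearMap.mulRight K f) ∘ₗ LinearMap.mul K (CuspAlgebra K m))
    have key : a ∈ N := by
      refine mem_of_mono_mem N (fun j hj => ?_) a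
      obtain ⟨Q, hQ, hsymb⟩ := hf.commutator_mono hj
      refine ih _ Q hsymb fun k => ?_
      rw [hQ]
      set p := P (k - j) with hp
      by_cases h0 : p = 0
      · simp [h0]
      · have h1 : (taylor (j : K) p - p).degree < (taylor (j : K) p).degree :=
          degree_sub_lt_left (degree_taylor _ _) (by simpa using h0) (leadingCoeff_taylor _ _)
        rw [degree_taylor] at h1
        have h2 := hP (k - j)
        rw [← hp, Nat.cast_add_one] at h2
        rw [degree_eq_natDegree h0] at h1 h2
        refine h1.trans_le ?_
        norm_cast at h2 ⊢
        omega
    exact key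

theorem mem_diffOps [CharZero K] (hf : IsSymbol f P) : f ∈ diffOps K (CuspAlgebra K m) := by
  obtain ⟨n, hn⟩ := exists_mem_symbolBox P
  refine ⟨n + 1, mem_diffOpOrderLT _ f P hf fun k => ?_⟩
  by_cases h0 : P k = 0
  · rw [h0, degree_zero]
    exact WithBot.bot_lt_coe _
  · rw [degree_eq_natDegree h0]
    have := (mem_symbolBox_iff.mp hn k h0).2
    norm_cast
    omega

end IsSymbol

/-! ### Existence of symbols and of operators with a given symbol -/

theorem intCoeff_commutator (f : Module.End K (CuspAlgebra K m)) {j s : ℕ}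
    (hj : IsExponent m j) (hs : IsExponent m s) (k : ℤ) :
    intCoeff (s + (k + j)) (incl K m ((f * LinearMap.mulLeft K (mono K m j) -
      LinearMap.mulLeft K (mono K m j) * f) (mono K m s))) =
      intCoeff ((s + j : ℕ) + k) (incl K m (f (mono K m (s + j)))) -
        intCoeff (s + k) (incl K m (f (mono K m s))) := by
  simp only [LinearMap.sub_apply, Module.End.mul_apply, LinearMap.mulLeft_apply, map_sub, map_mul,
    mono_mul_mono hj hs, incl_mono hj, intCoeff_X_pow_mul]
  rw [add_comm j s, show ((s + j : ℕ) : ℤ) + k = s + (k + j) by push_cast; ring,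
    show (s : ℤ) + (k + j) - j = s + k by ring]

/-- By induction the commutators with x^m and x^(m+1) have symbols, so each weight coefficient of f
has polynomial differences with steps m and m + 1 and is itself polynomial. -/
theorem exists_isSymbol_of_mem [CharZero K] (hm : 0 < m) (n : ℕ) : ∀ f ∈ diffOpOrderLT K (CuspAlgebra K m) n,
    ∃ P, IsSymbol f P := by
  classical
  induction n with
  | zero =>
    intro f hf
    obtain rfl : f = 0 := hf
    exact ⟨0, fun s _ k => by simp⟩
  | succ n ih =>
    intro f hf
    have hem : IsExponent m (m : ℕ) := Or.inr le_rfl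
    have hem' : IsExponent m (m + 1 : ℕ) := Or.inr (by push_cast; omega)
    have hz : IsExponent m (0 : ℕ) := Or.inl rfl
    obtain ⟨P₁, hP₁⟩ := ih _ (hf (mono K m m))
    obtain ⟨P₂, hP₂⟩ := ih _ (hf (mono K m (m + 1)))
    have hd₁ : ∀ k : ℤ, ∀ s, (s = 0 ∨ m ≤ s) →
        intCoeff ((s + m : ℕ) + k) (incl K m (f (mono K m (s + m)))) -
          intCoeff (s + k) (incl K m (f (mono K m s))) = (P₁ (k + m)).eval (s : K) := by
      intro k s hs
      have hs' : IsExponent m s := isExponent_natCast.mpr hs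
      rw [← hP₁ s hs', intCoeff_commutator f hem hs']
    have hd₂ : ∀ k : ℤ, ∀ s, (s = 0 ∨ m ≤ s) →
        intCoeff ((s + (m + 1) : ℕ) + k) (incl K m (f (mono K m (s + (m + 1))))) -
          intCoeff (s + k) (incl K m (f (mono K m s))) =
            (P₂ (k + (m + 1 : ℕ))).eval (s : K) := by
      intro k s hs
      have hs' : IsExponent m s := isExponent_natCast.mpr hs
      rw [← hP₂ s hs', intCoeff_commutator f hem' hs']
    choose g hg using fun k : ℤ => exists_polynomial_of_differences m
      (fun s => intCoeff (s + k) (incl K m (f (mono K m s)))) _ _ (hd₁ k) (hd₂ k)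
    -- Only finitely many weights occur: if weight k + m is absent from the commutator with x^m and
    -- x^k from f(1), then g k vanishes at all multiples of m.
    have hfin : ∀ k, g k ≠ 0 → k ∈ P₁.support.image (fun i => i - (m : ℤ)) ∪
        (incl K m (f (mono K m 0))).support.image (fun i : ℕ => (i : ℤ)) := by
      intro k hk
      by_contra hnot
      rw [Finset.mem_union, not_or] at hnot
      have h1 : P₁ (k + m) = 0 := by
        by_contra hne
        exact hnot.1 (Finset.mem_image.mpr ⟨k + m, Finsupp.mem_support_iff.mpr hne, by ring⟩)
      have h2 : intCoeff k (incl K m (f (mono K m 0))) = 0 := by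
        rcases lt_or_ge k 0 with hk0 | hk0
        · exact intCoeff_of_neg hk0 _
        · lift k to ℕ using hk0
          rw [intCoeff_natCast]
          by_contra hne
          exact hnot.2 (Finset.mem_image.mpr ⟨k, mem_support_iff.mpr hne, rfl⟩)
      have h3 : ∀ t : ℕ, (g k).eval ((m * t : ℕ) : K) = 0 := by
        intro t
        have hexp : ∀ t : ℕ, m * t = 0 ∨ m ≤ m * t := fun t => by
          rcases t with _ | t
          · exact Or.inl rfl
          · exact Or.inr (Nat.le_mul_of_pos_right _ t.succ_pos)
        induction t with
        | zero =>
          have := hg k 0 (Or.inl rfl)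
          simp only [Nat.cast_zero, zero_add, h2] at this
          simpa using this.symm
        | succ t iht =>
          have h4 := hd₁ k (m * t) (hexp t)
          rw [h1, eval_zero, sub_eq_zero] at h4
          rw [← hg k _ (hexp (t + 1)), mul_add, mul_one, h4, hg k _ (hexp t), iht]
      refine hk (eq_zero_of_infinite_isRoot _ (Set.infinite_of_injective_forall_mem
        (f := fun t : ℕ => ((m * t : ℕ) : K)) ?_ h3))
      intro a b hab
      exact Nat.eq_of_mul_eq_mul_left hm (Nat.cast_injective hab)
    exact ⟨Finsupp.onFinset _ g hfin, fun s hs k => hg k s (isExponent_natCast.mp hs)⟩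

/-- The hypothesis kills exactly the monomials that would be sent out of A(m); it also makes `toNat`
harmless, as negative integers are not exponents. -/
theorem exists_isSymbol_single {k : ℤ} {p : K[X]}
    (hp : ∀ s : ℕ, IsExponent m s → ¬ IsExponent m (s + k) → p.eval (s : K) = 0) :
    ∃ f : Module.End K (CuspAlgebra K m), IsSymbol f (Finsupp.single k p) := by
  let L : K[X] →ₗ[K] K[X] := (basisMonomials K).constr K
    fun s => p.eval (s : K) • X ^ ((s : ℤ) + k).toNat
  have hL : ∀ s : ℕ, L (X ^ s) = p.eval (s : K) • X ^ ((s : ℤ) + k).toNat := fun s => by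
    rw [← monomial_one_right_eq_X_pow,
      ← show basisMonomials K s = monomial s 1 from congrFun (coe_basisMonomials K) s,
      Module.Basis.constr_basis]
  have hmem : ∀ a : CuspAlgebra K m, L (incl K m a) ∈ cuspSubalgebra K m := by
    intro a
    refine mem_of_mono_mem ((Subalgebra.toSubmodule (cuspSubalgebra K m)).comap
      (L ∘ₗ (incl K m).toLinearMap)) (fun s hs => ?_) a
    rw [Submodule.mem_comap, LinearMap.comp_apply, AlgHom.toLinearMap_apply, incl_mono hs, hL]
    by_cases hk : IsExponent m (s + k)
    · refine Submodule.smul_mem _ _ (X_pow_mem ?_)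
      rwa [Int.toNat_of_nonneg (by rcases hk with h | h <;> omega)]
    · rw [hp s hs hk, zero_smul]
      exact Submodule.zero_mem _
  let f : Module.End K (CuspAlgebra K m) :=
    { toFun := fun a => ofMem (L (incl K m a)) (hmem a)
      map_add' := fun a b => incl_injective (by
        simp only [map_add, incl_ofMem])
      map_smul' := fun c a => incl_injective (by
        simp only [map_smul, incl_ofMem, RingHom.id_apply]) }
  refine ⟨f, fun s hs j => ?_⟩
  change intCoeff (s + j) (L (incl K m (mono K m s))) = _
  rw [incl_mono hs, hL, map_smul, intCoeff_X_pow, smul_eq_mul]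
  by_cases hk : IsExponent m (s + k)
  · rw [Int.toNat_of_nonneg (by rcases hk with h | h <;> omega)]
    by_cases hj : j = k
    · subst hj
      simp
    · rw [Finsupp.single_eq_of_ne hj, if_neg (by omega), mul_zero, eval_zero]
  · rw [hp s hs hk, zero_mul]
    by_cases hj : j = k
    · subst hj
      rw [Finsupp.single_eq_same, hp s hs hk]
    · rw [Finsupp.single_eq_of_ne hj, eval_zero]

end Basic

end CuspAlgebra

namespace CuspAlgebra

section Symbol

variable {K : Type u} [Field K] [CharZero K] {m : ℕ} (hm : 0 < m)

include hm in
theorem exists_isSymbol (f : diffOps K (CuspAlgebra K m)) :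
    ∃ P, IsSymbol (f : Module.End K (CuspAlgebra K m)) P :=
  f.2.elim fun n hn => exists_isSymbol_of_mem hm n _ hn

/-- The symbol of a differential operator on `A(m)`. -/
noncomputable def symbol : diffOps K (CuspAlgebra K m) →ₗ[K] (ℤ →₀ K[X]) where
  toFun f := (exists_isSymbol hm f).choose
  map_add' f g := (exists_isSymbol hm (f + g)).choose_spec.unique
    ((exists_isSymbol hm f).choose_spec.add (exists_isSymbol hm g).choose_spec)
  map_smul' c f := (exists_isSymbol hm (c • f)).choose_spec.unique
    ((exists_isSymbol hm f).choose_spec.smul c)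

theorem isSymbol_symbol (f : diffOps K (CuspAlgebra K m)) :
    IsSymbol (f : Module.End K (CuspAlgebra K m)) (symbol hm f) :=
  (exists_isSymbol hm f).choose_spec

theorem symbol_injective : Function.Injective (symbol (K := K) hm) := fun f g h =>
  Subtype.ext ((isSymbol_symbol hm f).ext (h ▸ isSymbol_symbol hm g))

theorem symbol_mul (f g : diffOps K (CuspAlgebra K m)) :
    symbol hm (f * g) = skewMul (symbol hm f) (symbol hm g) :=
  (isSymbol_symbol hm (f * g)).unique ((isSymbol_symbol hm f).mul (isSymbol_symbol hm g))

theorem symbol_one : symbol (K := K) hm 1 = Finsupp.single 0 1 :=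
  (isSymbol_symbol hm 1).unique IsSymbol.one

theorem exists_symbol_eq_single {k : ℤ} {p : K[X]}
    (hp : ∀ s : ℕ, IsExponent m s → ¬ IsExponent m (s + k) → p.eval (s : K) = 0) :
    ∃ f : diffOps K (CuspAlgebra K m), symbol hm f = Finsupp.single k p := by
  obtain ⟨f, hf⟩ := exists_isSymbol_single hp
  exact ⟨⟨f, hf.mem_diffOps⟩, (isSymbol_symbol hm _).unique hf⟩

end Symbol

/-! ### Weight shifting operators and their norms -/

section WeightPoly

variable (K : Type u) [Field K] (m : ℕ)

/-- The polynomial whose roots are the exponents `i` for which `i + k` is not an exponent. -/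
noncomputable def weightPoly (k : ℤ) : K[X] :=
  ∏ i ∈ (Finset.range (k.natAbs + m)).filter
    (fun i : ℕ => IsExponent m i ∧ ¬ IsExponent m (i + k)), (X - C (i : K))

theorem weightPoly_eval_natCast {k : ℤ} {s : ℕ} (hs : IsExponent m s)
    (hk : ¬ IsExponent m (s + k)) : (weightPoly K m k).eval (s : K) = 0 := by
  rw [weightPoly, eval_prod]
  refine Finset.prod_eq_zero (i := s) (Finset.mem_filter.mpr ⟨?_, hs, hk⟩) (by simp)
  rw [Finset.mem_range]
  unfold IsExponent at hk
  omega

theorem natDegree_weightPoly_le (k : ℤ) : (weightPoly K m k).natDegree ≤ k.natAbs + m := by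
  rw [weightPoly, natDegree_finsetProd_X_sub_C_eq_card]
  exact (Finset.card_filter_le _ _).trans (Finset.card_range _).le

/-- The polynomial `q` with `v (-k) * v k = q(θ)` for the weight shifting operators `v`. -/
noncomputable def weightNorm (k : ℤ) : K[X] :=
  taylor (k : K) (weightPoly K m (-k)) * weightPoly K m k

/-- Both factors are products of linear polynomials with integer roots. -/
theorem exists_intCast_of_dvd_weightNorm {g : K[X]} (hg : Irreducible g) {k : ℤ}
    (h : g ∣ weightNorm K m k) : ∃ a : ℤ, g ∣ X - C (a : K) := by
  have hp : Prime g := hg.prime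
  rcases hp.dvd_or_dvd h with h | h
  · rw [weightPoly, ← taylorAlgHom_apply, map_prod] at h
    obtain ⟨i, -, hi⟩ := hp.exists_mem_finset_dvd h
    refine ⟨i - k, ?_⟩
    convert hi using 1
    rw [taylorAlgHom_apply, map_sub, taylor_X, taylor_C]
    simp only [Int.cast_sub, Int.cast_natCast, map_sub]
    ring
  · rw [weightPoly] at h
    obtain ⟨i, -, hi⟩ := hp.exists_mem_finset_dvd h
    exact ⟨i, by simpa using hi⟩

variable [CharZero K]

theorem weightPoly_eval_ne_zero {k a : ℤ} (h : IsExponent m a → IsExponent m (a + k)) :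
    (weightPoly K m k).eval (a : K) ≠ 0 := by
  rw [weightPoly, eval_prod, Finset.prod_ne_zero_iff]
  intro i hi h0
  rw [eval_sub, eval_X, eval_C, sub_eq_zero] at h0
  have hai : a = i := by exact_mod_cast h0
  subst hai
  exact (Finset.mem_filter.mp hi).2.2 (h (Finset.mem_filter.mp hi).2.1)

/-- The norm vanishes at a only if the shift by k leaves the set of exponents at a or the shift back
leaves it at a + k. -/
theorem weightNorm_eval_ne_zero {k a : ℤ} (h : IsExponent m a ↔ IsExponent m (a + k)) :
    (weightNorm K m k).eval (a : K) ≠ 0 := by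
  rw [weightNorm, eval_mul, taylor_eval]
  refine mul_ne_zero ?_ (weightPoly_eval_ne_zero K m h.mp)
  rw [← Int.cast_add]
  refine weightPoly_eval_ne_zero K m fun h' => ?_
  rw [add_neg_cancel_right]
  exact h.mpr h'

theorem weightNorm_growth (g : K[X]) (hg : Irreducible g) : ∃ c : ℕ, ∀ n : ℕ, ∃ s : Finset ℤ,
    n ≤ s.card + c ∧ ∀ k ∈ s, k.natAbs ≤ n ∧ ¬ g ∣ weightNorm K m k := by
  by_cases ha : ∃ a : ℤ, g ∣ X - C (a : K)
  · obtain ⟨a, ha⟩ := ha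
    have hroot : ∀ k, (IsExponent m a ↔ IsExponent m (a + k)) → ¬ g ∣ weightNorm K m k := by
      intro k hk hdvd
      have h1 : X - C (a : K) ∣ weightNorm K m k :=
        (hg.associated_of_dvd (irreducible_X_sub_C _) ha).symm.dvd.trans hdvd
      exact weightNorm_eval_ne_zero K m hk (dvd_iff_isRoot.mp h1)
    refine ⟨m + a.natAbs, fun n => ?_⟩
    by_cases hexp : IsExponent m a
    -- For an exponent a, such a large k makes a + k ≥ m an exponent too.
    · refine ⟨Finset.Ioc ((m + a.natAbs : ℕ) : ℤ) n, ?_, fun k hk => ?_⟩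
      · rw [Int.card_Ioc]
        omega
      · rw [Finset.mem_Ioc] at hk
        refine ⟨by omega, hroot k ⟨fun _ => Or.inr (by omega), fun _ => hexp⟩⟩
    -- For a non-exponent a, such a negative k makes a + k negative, again a non-exponent.
    · refine ⟨Finset.Ico (-(n : ℤ)) (-((m + a.natAbs : ℕ) : ℤ)), ?_, fun k hk => ?_⟩
      · rw [Int.card_Ico]
        omega
      · rw [Finset.mem_Ico] at hk
        refine ⟨by omega, hroot k ⟨fun h => absurd h hexp, fun h => ?_⟩⟩
        rcases h with h | h <;> omega
  · refine ⟨0, fun n => ⟨Finset.Ioc 0 (n : ℤ), by simp, fun k hk => ?_⟩⟩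
    rw [Finset.mem_Ioc] at hk
    exact ⟨by omega, fun h => ha (exists_intCast_of_dvd_weightNorm K m hg h)⟩

end WeightPoly

/-! ### The filtration of 𝒟(A(m)) -/

section Filtration

variable (K : Type u) [Field K] [CharZero K] {m : ℕ} (hm : 0 < m)

/-- The Euler operator `x ∂` on `A(m)`. -/
noncomputable def euler : diffOps K (CuspAlgebra K m) :=
  (exists_symbol_eq_single (K := K) hm (k := 0) (p := X) fun s hs h =>
    absurd (by simpa using hs) h).choose

theorem symbol_euler : symbol hm (euler K hm) = Finsupp.single 0 X :=
  Exists.choose_spec (exists_symbol_eq_single (K := K) hm (k := 0) (p := X) fun s hs h =>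
    absurd (by simpa using hs) h)

/-- The weight shifting operator of weight `k` of least order on `A(m)`. -/
noncomputable def shift (k : ℤ) : diffOps K (CuspAlgebra K m) :=
  (exists_symbol_eq_single (K := K) hm (k := k) (p := weightPoly K m k) fun _ hs h =>
    weightPoly_eval_natCast K m hs h).choose

theorem symbol_shift (k : ℤ) : symbol hm (shift K hm k) = Finsupp.single k (weightPoly K m k) :=
  Exists.choose_spec (exists_symbol_eq_single (K := K) hm (k := k) (p := weightPoly K m k)
    fun _ hs h => weightPoly_eval_natCast K m hs h)

/-- The filtration of `𝒟(A(m))` by the degree in `x`, `x⁻¹` and in the Euler operator. -/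
noncomputable def weightFiltration : WeightFiltration K (diffOps K (CuspAlgebra K m)) :=
  WeightFiltration.ofSymbol (symbol hm) (symbol_injective hm) (symbol_one hm) (symbol_mul hm)
    (symbol_euler K hm) (symbol_shift K hm) (natDegree_weightPoly_le K m) (weightNorm_growth K m)

end Filtration

end CuspAlgebra

theorem theorem2p9 {K : Type*} [Field K] [CharZero K] (m : ℕ) (hm : 2 ≤ m) :
    HasLeftKrullDim (diffOps K (CuspAlgebra K m)) 1 ∧
      HasRightKrullDim (diffOps K (CuspAlgebra K m)) 1 := by
  have hm0 : 0 < m := by omega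
  have : NoZeroDivisors (diffOps K (CuspAlgebra K m)) :=
    noZeroDivisors_of_symbol (R := diffOps K (CuspAlgebra K m)) (CuspAlgebra.symbol hm0)
      (CuspAlgebra.symbol_injective hm0) (CuspAlgebra.symbol_mul hm0)
  have : Nontrivial (diffOps K (CuspAlgebra K m)) :=
    nontrivial_of_symbol (R := diffOps K (CuspAlgebra K m)) (CuspAlgebra.symbol hm0)
      (CuspAlgebra.symbol_one hm0)
  exact ⟨(CuspAlgebra.weightFiltration K hm0).hasLeftKrullDim,
    (CuspAlgebra.weightFiltration K hm0).hasRightKrullDim⟩
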